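/- **Theorem (Convergence of the $0^{\text{th}}$-order EigenGame for all players).** *Setting.* Let $M\in\mathbb R^{p\times p}$ be symmetric positive semidefinite with eigenvalues $\Lambda_{11}\ge\Lambda_{22}\ge\dots\ge\Lambda_{pp}\ge 0$ and a corresponding orthonormal basis of eigenvectors $v_1^\star,\dots,v_p^\star$; put $\Lambda_{p+1,p+1}:=0$. Let $1\le k\le p$, let $g_i=\Lambda_{ii}-\Lambda_{i+1,i+1}$, and assume $g_i>0$ for $i=1,\dots,k$. Write $\kappa_j=\Lambda_{11}/\Lambda_{jj}$, and $\angle$ for the angle in $[0,\pi]$. *Algorithm.* Player $i$, with unit vectors $v_1,\dots,v_{i-1}$ as parents, perturbation $\sigma\in\mathbb R$ and step size $\alpha$, starts at a unit vector $v_{i,\mathrm{init}}$ and in each iteration replaces $v$ by $\tilde v/\|\tilde v\|_2$, where $\tilde v=v+\alpha\widetilde\nabla f(v\mid v_{j<i})$ and $$\widetilde\nabla f(v\mid v_{j<i})=2M\Big(v-\sum_{j<i}\tfrac{v^\top Mv_j}{v_j^\top Mv_j}v_j\Big)+E_i(v_{j<i}),\qquad E_i(v_{j<i})=\sigma\Big(\mathrm{diag}(M)-\sum_{j<i}\tfrac{(Mv_j)^{\circ2}}{v_j^\top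 Mv_j}\Big)$$ ($\mathrm{diag}(M)$ is the vector of diagonal entries, $^{\circ 2}$ the entrywise square). For constants $c_i$ call the parents of player $i$ *$c_i$-accurate* if $\angle(v_j,v_j^\star)\le\frac{c_ig_i}{(i-1)\Lambda_{11}}$ for all $j<i$. (For $c_i\le\frac1{16}$ the right-hand side is at most $\sqrt{1/2}$.) For $2\le i\le k$ let $$L_i(\sigma)=4\big(\Lambda_{11}i+(1+\kappa_{i-1})c_ig_i\big)+|\sigma|\big(\|\mathrm{diag}(M)\|_2+2(i-1)\Lambda_{11}\kappa_{i-1}\big),$$ and let $L_1(\sigma)=4\Lambda_{11}+|\sigma|\,\|\mathrm{diag}(M)\|_2$. *Claim.* For every $a>0$ there is a constant $C>0$, depending only on $a$, such that the following holds for all $M$, $p$, $k$ as above, all $\phi_{\mathrm{tol}}>0$, all $\sigma\in\mathbb R$, all step sizes $\alpha$ with $\alpha\Lambda_{11}\ge a$, and all unit initial vectors with $\angle(v_{i,\mathrm{init}},v_i^\star)\le\frac\pi4$, $i=1,\dots,k$. Put $$T=\Big\lceil C\sum_{i=1}^k\frac{L_i(0)}{L_i(\sigma)}\Big[\frac{(k-1)!}{\phi_{\mathrm{tol}}}\prod_{j=1}^k\frac{16\Lambda_{11}}{g_j}\Big]^2\Big\rceil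 .$$ 1. *(Given accurate parents.)* Let $0\le c_i\le\frac1{16}$ and $16c_i\le\phi_{\mathrm{tol}}$ for $i\le k$, let every player $i\le k$ be given $c_i$-accurate unit parents, and assume that the finite-difference error is below the tolerance, $\|E_i(v_{j<i})\|_2<\frac{g_i\phi_{\mathrm{tol}}}{2\pi}$ for $i\le k$. Then $\|\widetilde\nabla f(v\mid v_{j<i})\|_2\le L_i(\sigma)$ for all unit vectors $v$ and all $i\le k$, and there are iteration counts $t_1,\dots,t_k$ with $\sum_i t_i\le T$ such that, for every $i\le k$, the vector that player $i$ returns after $t_i$ iterations makes an angle less than $\phi_{\mathrm{tol}}$ with $v_i^\star$. 2. *(All players in sequence.)* Let $$c_i=\frac{(i-1)!\,\prod_{j=i+1}^kg_j}{(16\Lambda_{11})^{k-i}(k-1)!}\cdot\frac{\phi_{\mathrm{tol}}}{16}\qquad(1\le i\le k),$$ and use these constants in $L_i(\sigma)$ and in $T$. Assume that $\|E_i(v_{j<i})\|_2<\frac{8c_ig_i}{\pi}$ for every $i\le k$ and all $c_i$-accurate unit parents $v_{j<i}$ of player $i$. Run the players $1,\dots,k$ one after the other, each one using the vectors returned by its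 predecessors as its parents. Then there are iteration counts $t_1,\dots,t_k$ with $\sum_it_i\le T$ such that the vector returned by player $i$ makes an angle less than $\phi_{\mathrm{tol}}$ with $v_i^\star$, for every $i\le k$; moreover, if $\phi_{\mathrm{tol}}\le1$, the parents that occur in this run are $c_i$-accurate for every $i\le k$. -/

import Mathlib

noncomputable section

namespace ZerothEigenGame

/-- `ℝ^p` with the Euclidean norm. -/
abbrev Vec (p : ℕ) := EuclideanSpace ℝ (Fin p)

/-- The matrix-vector product `M v`. -/
def act {p : ℕ} (M : Matrix (Fin p) (Fin p) ℝ) (v : Vec p) : Vec p :=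
  WithLp.toLp 2 (Matrix.mulVec M v.ofLp)

/-- The bilinear form `v^⊤ M w`. -/
def form {p : ℕ} (M : Matrix (Fin p) (Fin p) ℝ) (v w : Vec p) : ℝ :=
  inner ℝ v (act M w)

/-- The diagonal of `M`, as a vector. -/
def diagVec {p : ℕ} (M : Matrix (Fin p) (Fin p) ℝ) : Vec p :=
  WithLp.toLp 2 (fun m => M m m)

/-- The entrywise square of a vector. -/
def entrySq {p : ℕ} (v : Vec p) : Vec p :=
  WithLp.toLp 2 (fun m => v m ^ 2)

/-! Players are numbered from `0`: player `i` has the `i` parents `u 0, …, u (i - 1)`. -/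

/-- The analytical gradient `2 M (v - ∑_{j<i} (v^⊤ M u_j / u_j^⊤ M u_j) u_j)` of the utility. -/
def utilityGrad {p : ℕ} (M : Matrix (Fin p) (Fin p) ℝ) (i : ℕ) (u : ℕ → Vec p) (v : Vec p) :
    Vec p :=
  (2 : ℝ) • act M (v - ∑ j ∈ Finset.range i, (form M v (u j) / form M (u j) (u j)) • u j)

/-- The finite-difference error `σ (diag M - ∑_{j<i} (M u_j)^{∘2} / u_j^⊤ M u_j)`. -/
def fdError {p : ℕ} (M : Matrix (Fin p) (Fin p) ℝ) (σ : ℝ) (i : ℕ) (u : ℕ → Vec p) : Vec p :=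
  σ • (diagVec M
    - ∑ j ∈ Finset.range i, (form M (u j) (u j))⁻¹ • entrySq (act M (u j)))

/-- The forward finite-difference gradient used by player `i`. -/
def fdGrad {p : ℕ} (M : Matrix (Fin p) (Fin p) ℝ) (σ : ℝ) (i : ℕ) (u : ℕ → Vec p) (v : Vec p) :
    Vec p :=
  utilityGrad M i u v + fdError M σ i u

/-- One iteration: an ascent step of size `α`, then normalization. -/
def fdStep {p : ℕ} (M : Matrix (Fin p) (Fin p) ℝ) (σ α : ℝ) (i : ℕ) (u : ℕ → Vec p)
    (v : Vec p) : Vec p :=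
  ‖v + α • fdGrad M σ i u v‖⁻¹ • (v + α • fdGrad M σ i u v)

/-- The vector returned by player `i` with parents `u`, started at `v₀`, after `t` iterations. -/
def play {p : ℕ} (M : Matrix (Fin p) (Fin p) ℝ) (σ α : ℝ) (i : ℕ) (u : ℕ → Vec p)
    (v₀ : Vec p) (t : ℕ) : Vec p :=
  (fdStep M σ α i u)^[t] v₀

/-- The players run one after the other: player `i` starts at `init i`, makes `t i` iterations,
and uses as parents the vectors returned by the players before it. -/
def eigenGame {p : ℕ} (M : Matrix (Fin p) (Fin p) ℝ) (σ α : ℝ) (init : ℕ → Vec p) (t : ℕ → ℕ)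
    (i : ℕ) : Vec p :=
  play M σ α i (fun j => if _h : j < i then eigenGame M σ α init t j else 0) (init i) (t i)
termination_by i

/-- The eigenvalue number `n` (counted from `0`), continued by `0` beyond the dimension. -/
def eig {p : ℕ} (Λ : Fin p → ℝ) (n : ℕ) : ℝ := if h : n < p then Λ ⟨n, h⟩ else 0

/-- The eigengap between consecutive eigenvalues. -/
def gap {p : ℕ} (Λ : Fin p → ℝ) (n : ℕ) : ℝ := eig Λ n - eig Λ (n + 1)

/-- The ratio of the top eigenvalue to the eigenvalue number `n`. -/
def kappa {p : ℕ} (Λ : Fin p → ℝ) (n : ℕ) : ℝ := eig Λ 0 / eig Λ n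

/-- The angular accuracy `c_i g_i / (#parents * Λ₁₁)` that player `i` asks of its parents. -/
def parentTol {p : ℕ} (Λ : Fin p → ℝ) (c : ℕ → ℝ) (i : ℕ) : ℝ :=
  c i * gap Λ i / (i * eig Λ 0)

/-- `u` holds parents for player `i` that are unit vectors, each one within the accuracy
`parentTol` of the true eigenvector. -/
def AccurateParents {p : ℕ} (Λ : Fin p → ℝ) (v : OrthonormalBasis (Fin p) ℝ (Vec p))
    (c : ℕ → ℝ) (i : ℕ) (u : ℕ → Vec p) : Prop :=
  ∀ j : Fin p, (j : ℕ) < i →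
    ‖u j‖ = 1 ∧ InnerProductGeometry.angle (u j) (v j) ≤ parentTol Λ c i

/-- The gradient-norm bound `L_i(σ)`. The terms that come from the parents are absent for the
first player, which has none. -/
def lipBound {p : ℕ} (M : Matrix (Fin p) (Fin p) ℝ) (Λ : Fin p → ℝ) (c : ℕ → ℝ) (i : ℕ)
    (σ : ℝ) : ℝ :=
  if i = 0 then 4 * eig Λ 0 + |σ| * ‖diagVec M‖
  else 4 * (eig Λ 0 * (i + 1) + (1 + kappa Λ (i - 1)) * c i * gap Λ i)
    + |σ| * (‖diagVec M‖ + 2 * i * eig Λ 0 * kappa Λ (i - 1))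

/-- `∑_i L_i(0)/L_i(σ) * [ (k-1)!/φ * ∏_j (16 Λ₁₁ / g_j) ]²`. -/
def iterRate {p : ℕ} (M : Matrix (Fin p) (Fin p) ℝ) (Λ : Fin p → ℝ) (c : ℕ → ℝ) (k : ℕ)
    (σ φ : ℝ) : ℝ :=
  ∑ i ∈ Finset.range k, lipBound M Λ c i 0 / lipBound M Λ c i σ *
    ((Nat.factorial (k - 1) : ℝ) / φ * ∏ j ∈ Finset.range k, (16 * eig Λ 0 / gap Λ j)) ^ 2

/-- The accuracy constants `c_i` for which `16 c_{k-1} = φ` and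
`16 c_{i-1} = c_i g_i / (i Λ₁₁)` (players numbered from `0`). -/
def seqConst {p : ℕ} (Λ : Fin p → ℝ) (k : ℕ) (φ : ℝ) (i : ℕ) : ℝ :=
  (Nat.factorial i : ℝ) * (∏ j ∈ Finset.Ico (i + 1) k, gap Λ j)
    / ((16 * eig Λ 0) ^ (k - 1 - i) * (Nat.factorial (k - 1) : ℝ)) * (φ / 16)

end ZerothEigenGame

end

/-!
The gradient of player `i` is affine in its own vector: up to the constant `fdError` it is
`2 (M - ∑_{j<i} M u_j u_jᵀ M / u_jᵀ M u_j) v`. With exact parents this is `2 P v`, where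
`P = deflated` is `M` with the first `i` eigendirections removed, so that one iteration is a
shifted and noisy power step for `P`, whose top eigenvector is `v_i`, with eigengap `g_i`.

Two estimates make the noise small against the gap. By `norm_deflation_term_sub_le`, replacing
an exact parent by one at distance `δ` costs at most `11/5 Λ₁₁ δ`: the condition on the parents
makes `Λ₁₁ δ` small against `Λ_j`, so the denominators `u_jᵀ M u_j` cause no loss. Summed over the
parents and added to the finite-difference error this gives `norm_fdGrad_sub_deflated_le`: the
gradient error is at most `φ g_i / 2`.

The dynamics is followed through the tangent `τ` of the angle with `v_i` (`InCone`), which is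
invariant under normalization and at most `1` initially. While `φ ≤ τ ≤ 1`, the gain from the gap
beats the noise, and `τ` shrinks by a factor `1 - ρ` with `ρ` proportional to `g_i / Λ₁₁`
(`InCone.step`); since `s / (1 + 2 s)` is increasing, a lower bound on `s = α Λ₁₁` is all that is
needed of the step size, and there is no upper bound. Hence player `i` needs
`O(Λ₁₁ / (g_i φ))` iterations (`exists_play_angle_lt`).

In the sequential game player `i` works to the tolerance `16 c_i`, which is what all later players
ask of it (`sixteen_mul_seqConst_le_parentTol`). The iteration counts then form a series dominated
by a geometric one (`ratio_div_le`), and the summand of the first player in `iterRate` alone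
bounds their total up to a constant (`difficulty_sq_le_iterRate`, `sum_iterations_le_ceil`).
Tolerances above `1` are met by the initial vectors, because `π / 4 < 1`.
-/

namespace ZerothEigenGame
open InnerProductGeometry

/-! ### The spectrum of `M` -/

section Spectrum

variable {p : ℕ} {M : Matrix (Fin p) (Fin p) ℝ} {Λ : Fin p → ℝ}
  {v : OrthonormalBasis (Fin p) ℝ (Vec p)}

lemma act_eq_toEuclideanLin (M : Matrix (Fin p) (Fin p) ℝ) (x : Vec p) :
    act M x = Matrix.toEuclideanLin M x := rfl

lemma act_add (x y : Vec p) : act M (x + y) = act M x + act M y := by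
  simp only [act_eq_toEuclideanLin, map_add]

lemma act_sub (x y : Vec p) : act M (x - y) = act M x - act M y := by
  simp only [act_eq_toEuclideanLin, map_sub]

lemma act_smul (r : ℝ) (x : Vec p) : act M (r • x) = r • act M x := by
  simp only [act_eq_toEuclideanLin, map_smul]

lemma act_sum {ι : Type*} (s : Finset ι) (f : ι → Vec p) :
    act M (∑ j ∈ s, f j) = ∑ j ∈ s, act M (f j) := by
  simp only [act_eq_toEuclideanLin, map_sum]

lemma inner_act_comm (hM : M.PosSemidef) (x y : Vec p) :
    inner ℝ (act M x) y = inner ℝ x (act M y) :=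
  (Matrix.isSymmetric_toEuclideanLin_iff.2 hM.isHermitian) x y

lemma form_eq_inner_act (x y : Vec p) :
    form M x y = inner ℝ (act M y) x := by
  rw [form, real_inner_comm]

lemma inner_basis_act (hM : M.PosSemidef) (hv : ∀ l, act M (v l) = Λ l • v l) (l : Fin p)
    (x : Vec p) : inner ℝ (v l) (act M x) = Λ l * inner ℝ (v l) x := by
  rw [← inner_act_comm hM, hv, real_inner_smul_left]

lemma form_self_eq_sum (hM : M.PosSemidef) (hv : ∀ l, act M (v l) = Λ l • v l) (x : Vec p) :
    form M x x = ∑ l, Λ l * inner ℝ (v l) x ^ 2 := by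
  rw [form, ← v.sum_inner_mul_inner x (act M x)]
  refine Finset.sum_congr rfl fun l _ => ?_
  rw [inner_basis_act hM hv, real_inner_comm (v l) x]
  ring

lemma norm_sq_eq_sum (v : OrthonormalBasis (Fin p) ℝ (Vec p)) (x : Vec p) :
    ‖x‖ ^ 2 = ∑ l, inner ℝ (v l) x ^ 2 := by
  rw [← v.sum_sq_norm_inner_right x]
  simp

lemma eigenvalue_nonneg (hM : M.PosSemidef) (hv : ∀ l, act M (v l) = Λ l • v l) (l : Fin p) :
    0 ≤ Λ l := by
  have h : inner ℝ (v l) (act M (v l)) = Λ l := by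
    rw [hv, real_inner_smul_right, real_inner_self_eq_norm_sq, v.norm_eq_one]; ring
  rw [← h]
  have := hM.dotProduct_mulVec_nonneg (v l).ofLp
  simpa [act, EuclideanSpace.inner_eq_star_dotProduct, dotProduct_comm] using this

lemma eig_coe (Λ : Fin p → ℝ) (l : Fin p) : eig Λ l = Λ l := by simp [eig]

lemma eig_nonneg (h0 : ∀ l, 0 ≤ Λ l) (n : ℕ) : 0 ≤ eig Λ n := by
  unfold eig; split_ifs with h
  · exact h0 _
  · rfl

lemma eig_antitone (h0 : ∀ l, 0 ≤ Λ l) (hΛ : Antitone Λ) : Antitone (eig Λ) := by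
  intro m n hmn
  by_cases hn : n < p
  · simp only [eig, hn, hmn.trans_lt hn, dif_pos]
    exact hΛ hmn
  · rw [show eig Λ n = 0 by simp [eig, hn]]
    exact eig_nonneg h0 m

lemma gap_le_eig (h0 : ∀ l, 0 ≤ Λ l) (n : ℕ) : gap Λ n ≤ eig Λ n := by
  have := eig_nonneg h0 (n + 1)
  unfold gap; linarith

lemma gap_le_eig_zero (h0 : ∀ l, 0 ≤ Λ l) (hΛ : Antitone Λ) (n : ℕ) : gap Λ n ≤ eig Λ 0 :=
  (gap_le_eig h0 n).trans (eig_antitone h0 hΛ (Nat.zero_le n))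

lemma eigenvalue_le_eig_zero (h0 : ∀ l, 0 ≤ Λ l) (hΛ : Antitone Λ) (l : Fin p) :
    Λ l ≤ eig Λ 0 := by
  rw [← eig_coe Λ l]; exact eig_antitone h0 hΛ (Nat.zero_le _)

lemma form_self_nonneg (hM : M.PosSemidef) (hv : ∀ l, act M (v l) = Λ l • v l) (x : Vec p) :
    0 ≤ form M x x := by
  rw [form_self_eq_sum hM hv]
  exact Finset.sum_nonneg fun l _ => mul_nonneg (eigenvalue_nonneg hM hv l) (sq_nonneg _)

lemma form_self_le (hM : M.PosSemidef) (hΛ : Antitone Λ) (hv : ∀ l, act M (v l) = Λ l • v l)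
    (x : Vec p) : form M x x ≤ eig Λ 0 * ‖x‖ ^ 2 := by
  rw [form_self_eq_sum hM hv, norm_sq_eq_sum v, Finset.mul_sum]
  exact Finset.sum_le_sum fun l _ => mul_le_mul_of_nonneg_right
    (eigenvalue_le_eig_zero (eigenvalue_nonneg hM hv) hΛ l) (sq_nonneg _)

lemma norm_act_sq_le_form (hM : M.PosSemidef) (hΛ : Antitone Λ)
    (hv : ∀ l, act M (v l) = Λ l • v l) (x : Vec p) :
    ‖act M x‖ ^ 2 ≤ eig Λ 0 * form M x x := by
  rw [form_self_eq_sum hM hv, norm_sq_eq_sum v, Finset.mul_sum]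
  refine Finset.sum_le_sum fun l _ => ?_
  have h0 := eigenvalue_nonneg hM hv
  rw [inner_basis_act hM hv, ← mul_assoc, mul_pow, sq (Λ l)]
  exact mul_le_mul_of_nonneg_right
    (mul_le_mul_of_nonneg_right (eigenvalue_le_eig_zero h0 hΛ l) (h0 l)) (sq_nonneg _)

lemma norm_act_le (hM : M.PosSemidef) (hΛ : Antitone Λ) (hv : ∀ l, act M (v l) = Λ l • v l)
    (x : Vec p) : ‖act M x‖ ≤ eig Λ 0 * ‖x‖ := by
  have h0 := eig_nonneg (eigenvalue_nonneg hM hv) 0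
  refine le_of_sq_le_sq ?_ (mul_nonneg h0 (norm_nonneg x))
  calc ‖act M x‖ ^ 2 ≤ eig Λ 0 * form M x x := norm_act_sq_le_form hM hΛ hv x
    _ ≤ eig Λ 0 * (eig Λ 0 * ‖x‖ ^ 2) :=
      mul_le_mul_of_nonneg_left (form_self_le hM hΛ hv x) h0
    _ = (eig Λ 0 * ‖x‖) ^ 2 := by ring

end Spectrum

/-! ### The bound on the gradient -/

section GradientBound

variable {p : ℕ} {M : Matrix (Fin p) (Fin p) ℝ} {Λ : Fin p → ℝ}
  {v : OrthonormalBasis (Fin p) ℝ (Vec p)}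

lemma utilityGrad_eq (i : ℕ) (u : ℕ → Vec p) (w : Vec p) :
    utilityGrad M i u w = (2 : ℝ) • (act M w - ∑ j ∈ Finset.range i,
      (inner ℝ (act M (u j)) w / form M (u j) (u j)) • act M (u j)) := by
  simp only [utilityGrad, act_sub, act_sum, act_smul, form_eq_inner_act w]

lemma norm_entrySq_le (x : Vec p) : ‖entrySq x‖ ≤ ‖x‖ ^ 2 := by
  refine le_of_sq_le_sq ?_ (sq_nonneg _)
  simp only [EuclideanSpace.real_norm_sq_eq, entrySq]
  exact Finset.sum_sq_le_sq_sum_of_nonneg fun m _ => sq_nonneg _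

/-- `‖M x‖² / xᵀMx ≤ Λ₁₁`, also when the denominator vanishes. -/
lemma norm_act_sq_div_form_le (hM : M.PosSemidef) (hΛ : Antitone Λ)
    (hv : ∀ l, act M (v l) = Λ l • v l) (x : Vec p) :
    ‖act M x‖ ^ 2 / form M x x ≤ eig Λ 0 :=
  div_le_of_le_mul₀ (form_self_nonneg hM hv x) (eig_nonneg (eigenvalue_nonneg hM hv) 0)
    (norm_act_sq_le_form hM hΛ hv x)

lemma norm_utilityGrad_le (hM : M.PosSemidef) (hΛ : Antitone Λ)
    (hv : ∀ l, act M (v l) = Λ l • v l) (i : ℕ) (u : ℕ → Vec p) (w : Vec p) (hw : ‖w‖ = 1) :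
    ‖utilityGrad M i u w‖ ≤ 2 * (eig Λ 0 * (i + 1)) := by
  rw [utilityGrad_eq, norm_smul, Real.norm_two]
  refine mul_le_mul_of_nonneg_left ?_ zero_le_two
  have h1 : ‖act M w‖ ≤ eig Λ 0 := by simpa [hw] using norm_act_le hM hΛ hv w
  have h2 : ‖∑ j ∈ Finset.range i,
      (inner ℝ (act M (u j)) w / form M (u j) (u j)) • act M (u j)‖ ≤ i * eig Λ 0 := by
    refine (norm_sum_le_of_le _ (fun j _ => ?_)).trans_eq
      (by rw [Finset.sum_const, Finset.card_range, nsmul_eq_mul])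
    refine le_trans ?_ (norm_act_sq_div_form_le hM hΛ hv (u j))
    rw [norm_smul, norm_div, Real.norm_of_nonneg (form_self_nonneg hM hv (u j)), div_mul_eq_mul_div]
    refine div_le_div_of_nonneg_right ?_ (form_self_nonneg hM hv (u j))
    rw [sq]
    refine mul_le_mul_of_nonneg_right ?_ (norm_nonneg _)
    simpa [hw] using norm_inner_le_norm (𝕜 := ℝ) (act M (u j)) w
  calc _ ≤ _ := norm_sub_le _ _
    _ ≤ eig Λ 0 * (i + 1) := by linarith

lemma norm_fdError_le (hM : M.PosSemidef) (hΛ : Antitone Λ)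
    (hv : ∀ l, act M (v l) = Λ l • v l) (σ : ℝ) (i : ℕ) (u : ℕ → Vec p) :
    ‖fdError M σ i u‖ ≤ |σ| * (‖diagVec M‖ + i * eig Λ 0) := by
  rw [fdError, norm_smul, Real.norm_eq_abs]
  refine mul_le_mul_of_nonneg_left ?_ (abs_nonneg σ)
  refine (norm_sub_le _ _).trans (add_le_add le_rfl ?_)
  refine (norm_sum_le_of_le _ (fun j _ => ?_)).trans_eq
    (by rw [Finset.sum_const, Finset.card_range, nsmul_eq_mul])
  refine le_trans ?_ (norm_act_sq_div_form_le hM hΛ hv (u j))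
  have h := form_self_nonneg hM hv (u j)
  rw [norm_smul, norm_inv, Real.norm_of_nonneg h, inv_mul_eq_div]
  exact div_le_div_of_nonneg_right (norm_entrySq_le _) h

lemma norm_fdGrad_le_lipBound (hM : M.PosSemidef) (hΛ : Antitone Λ)
    (hv : ∀ l, act M (v l) = Λ l • v l) {c : ℕ → ℝ} {i : ℕ} (hc : 0 ≤ c i)
    (hg : 0 ≤ gap Λ i) (hg' : 0 < gap Λ (i - 1)) (σ : ℝ) (u : ℕ → Vec p) (w : Vec p)
    (hw : ‖w‖ = 1) :
    ‖fdGrad M σ i u w‖ ≤ lipBound M Λ c i σ := by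
  have h0 := eigenvalue_nonneg hM hv
  have hU := norm_utilityGrad_le hM hΛ hv i u w hw
  have hE := norm_fdError_le hM hΛ hv σ i u
  have hΛ0 := eig_nonneg h0 0
  refine (norm_add_le _ _).trans ((add_le_add hU hE).trans ?_)
  rcases Nat.eq_zero_or_pos i with rfl | hi
  · simp only [lipBound, if_true, Nat.cast_zero]
    linarith
  · have hpos : 0 < eig Λ (i - 1) := hg'.trans_le (gap_le_eig h0 _)
    have hκ : 1 ≤ kappa Λ (i - 1) :=
      (one_le_div hpos).2 (eig_antitone h0 hΛ (Nat.zero_le _))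
    rw [lipBound, if_neg hi.ne']
    have h1 : 0 ≤ (1 + kappa Λ (i - 1)) * c i * gap Λ i := by positivity
    have h2 : 0 ≤ eig Λ 0 * (i + 1) := by positivity
    have h3 : (i : ℝ) * eig Λ 0 ≤ 2 * i * eig Λ 0 * kappa Λ (i - 1) := by
      have : 0 ≤ (i : ℝ) * eig Λ 0 := by positivity
      nlinarith
    have h4 := mul_le_mul_of_nonneg_left (add_le_add_right h3 ‖diagVec M‖) (abs_nonneg σ)
    linarith

end GradientBound

/-! ### Perturbation by inaccurate parents -/

section Perturbation

variable {p : ℕ} {M : Matrix (Fin p) (Fin p) ℝ} {Λ : Fin p → ℝ}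
  {v : OrthonormalBasis (Fin p) ℝ (Vec p)}

lemma norm_sub_le_angle {E : Type*} [NormedAddCommGroup E] [InnerProductSpace ℝ E] {x y : E}
    (hx : ‖x‖ = 1) (hy : ‖y‖ = 1) : ‖x - y‖ ≤ angle x y := by
  refine le_of_sq_le_sq ?_ (angle_nonneg x y)
  have h1 := cos_angle_mul_norm_mul_norm x y
  have h2 := Real.one_sub_sq_div_two_le_cos (x := angle x y)
  rw [norm_sub_sq_real, ← h1, hx, hy]
  linarith

/-- The Rayleigh quotient of a unit vector near an eigenvector is accurate to second order. -/
lemma abs_form_sub_eigenvalue_le (hM : M.PosSemidef) (hΛ : Antitone Λ)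
    (hv : ∀ l, act M (v l) = Λ l • v l) {j : Fin p} {u : Vec p} (hu : ‖u‖ = 1) :
    |form M u u - Λ j| ≤ eig Λ 0 * ‖u - v j‖ ^ 2 := by
  obtain ⟨h, rfl⟩ : ∃ h, u = v j + h := ⟨u - v j, by abel⟩
  have h0 := eigenvalue_nonneg hM hv
  have hvj := v.norm_eq_one j
  have hin : inner ℝ (v j) h = -‖h‖ ^ 2 / 2 := by
    have := norm_add_sq_real (v j) h
    rw [hu, hvj] at this
    linarith
  have hform : form M (v j + h) (v j + h) = Λ j - Λ j * ‖h‖ ^ 2 + form M h h := by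
    have h1 : inner ℝ h (v j) = -‖h‖ ^ 2 / 2 := by rw [real_inner_comm]; exact hin
    simp only [form, act_add, inner_add_left, inner_add_right, inner_basis_act hM hv]
    rw [real_inner_self_eq_norm_sq, hvj, hv, real_inner_smul_right, h1, hin]
    ring
  have h1 := form_self_le hM hΛ hv h
  have h2 := form_self_nonneg hM hv h
  have h3 := mul_le_mul_of_nonneg_right (eigenvalue_le_eig_zero h0 hΛ j) (sq_nonneg ‖h‖)
  have h4 := mul_nonneg (h0 j) (sq_nonneg ‖h‖)
  rw [hform, add_sub_cancel_left, abs_le]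
  constructor <;> linarith

/-- Deflating by an approximate eigenvector `u` at distance `δ` from `v j` instead of by `v j`
itself costs an error proportional to `Λ₁₁ δ`. The condition `Λ₁₁ δ ≤ Λ_j / 16` keeps the
denominator `uᵀMu` close to `Λ_j`, so that no condition number enters. -/
lemma norm_deflation_term_sub_le (hM : M.PosSemidef) (hΛ : Antitone Λ)
    (hv : ∀ l, act M (v l) = Λ l • v l) {j : Fin p} {u : Vec p} (hu : ‖u‖ = 1) {δ : ℝ}
    (hδ : ‖u - v j‖ ≤ δ) (hδ' : δ ≤ 1 / 16) (hε : eig Λ 0 * δ ≤ Λ j / 16) (hj : 0 < Λ j)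
    (w : Vec p) :
    ‖(inner ℝ (act M u) w / form M u u) • act M u - (Λ j * inner ℝ (v j) w) • v j‖
      ≤ 11 / 5 * (eig Λ 0 * δ) * ‖w‖ := by
  have h0 := eig_nonneg (eigenvalue_nonneg hM hv) 0
  have hδ0 : 0 ≤ δ := (norm_nonneg _).trans hδ
  set ε := eig Λ 0 * δ with hε_def
  have hε0 : 0 ≤ ε := mul_nonneg h0 hδ0
  have hd : |form M u u - Λ j| ≤ ε / 16 := by
    refine (abs_form_sub_eigenvalue_le hM hΛ hv hu).trans ?_
    have : ‖u - v j‖ ^ 2 ≤ δ * (1 / 16) := by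
      rw [sq]; exact mul_le_mul hδ (hδ.trans hδ') (norm_nonneg _) hδ0
    have := mul_le_mul_of_nonneg_left this h0
    linarith
  set d := form M u u
  obtain ⟨hd1, hd2⟩ := abs_le.1 hd
  have hdΛ : 255 / 256 * Λ j ≤ d := by linarith
  have hd0 : 0 < d := by linarith
  obtain ⟨r, hr⟩ : ∃ r, act M u = Λ j • v j + r := ⟨act M u - Λ j • v j, by abel⟩
  have hrε : ‖r‖ ≤ ε := by
    have : r = act M (u - v j) := by rw [act_sub, hv, hr]; abel
    rw [this]
    exact (norm_act_le hM hΛ hv _).trans (mul_le_mul_of_nonneg_left hδ h0)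
  have hvj := v.norm_eq_one j
  have ha : |inner ℝ (v j) w| ≤ ‖w‖ := by simpa [hvj] using abs_real_inner_le_norm (v j) w
  have hs : |inner ℝ r w| ≤ ε * ‖w‖ :=
    (abs_real_inner_le_norm r w).trans (mul_le_mul_of_nonneg_right hrε (norm_nonneg w))
  set a : ℝ := inner ℝ (v j) w
  set s : ℝ := inner ℝ r w
  have hdecomp : (inner ℝ (act M u) w / d) • act M u - (Λ j * a) • v j
      = d⁻¹ • ((Λ j * (a * (Λ j - d)) + Λ j * s) • v j + (Λ j * a + s) • r) := by
    rw [hr, inner_add_left, real_inner_smul_left]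
    change ((Λ j * a + s) / d) • _ - _ = _
    match_scalars <;> field_simp
    ring
  have hW := norm_nonneg w
  have hd' : |Λ j - d| ≤ ε / 16 := by rw [abs_sub_comm]; exact hd
  have hn : ‖(Λ j * (a * (Λ j - d)) + Λ j * s) • v j + (Λ j * a + s) • r‖
      ≤ 17 / 8 * (Λ j * ε * ‖w‖) := by
    have h1 : |a * (Λ j - d)| ≤ ‖w‖ * (ε / 16) := by
      rw [abs_mul]; exact mul_le_mul ha hd' (abs_nonneg _) hW
    have h2 : |Λ j * (a * (Λ j - d)) + Λ j * s| ≤ Λ j * (‖w‖ * (ε / 16)) + Λ j * (ε * ‖w‖) := by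
      refine (abs_add_le _ _).trans ?_
      rw [abs_mul (Λ j), abs_mul (Λ j), abs_of_pos hj]
      exact add_le_add (mul_le_mul_of_nonneg_left h1 hj.le) (mul_le_mul_of_nonneg_left hs hj.le)
    have h3 : |Λ j * a + s| ≤ Λ j * ‖w‖ + ε * ‖w‖ := by
      refine (abs_add_le _ _).trans ?_
      rw [abs_mul, abs_of_pos hj]
      gcongr
    have h4 : |Λ j * a + s| * ‖r‖ ≤ (Λ j * ‖w‖ + ε * ‖w‖) * ε := by gcongr
    have h5 : ε * (ε * ‖w‖) ≤ Λ j / 16 * (ε * ‖w‖) := by gcongr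
    refine (norm_add_le _ _).trans ?_
    rw [norm_smul, norm_smul, hvj, Real.norm_eq_abs, Real.norm_eq_abs]
    linarith
  rw [hdecomp, norm_smul, norm_inv, Real.norm_of_nonneg hd0.le, inv_mul_le_iff₀ hd0]
  have h6 := mul_le_mul_of_nonneg_right hdΛ (mul_nonneg hε0 hW)
  have h7 : 0 ≤ Λ j * (ε * ‖w‖) := by positivity
  linarith

/-- Half of the noiseless gradient of player `i` for exact parents: `M w` with its components
along `v 0, …, v (i - 1)` removed. -/
noncomputable def deflated (M : Matrix (Fin p) (Fin p) ℝ) (Λ : Fin p → ℝ)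
    (v : OrthonormalBasis (Fin p) ℝ (Vec p)) (i : Fin p) (w : Vec p) : Vec p :=
  act M w - ∑ j : Fin i, (Λ (Fin.castLE i.2.le j) * inner ℝ (v (Fin.castLE i.2.le j)) w) •
    v (Fin.castLE i.2.le j)

lemma inner_basis_deflated (hM : M.PosSemidef) (hv : ∀ l, act M (v l) = Λ l • v l)
    (i l : Fin p) (w : Vec p) :
    inner ℝ (v l) (deflated M Λ v i w) = if l < i then 0 else Λ l * inner ℝ (v l) w := by
  rw [deflated, inner_sub_right, inner_basis_act hM hv, inner_sum]
  simp only [real_inner_smul_right, orthonormal_iff_ite.1 v.orthonormal, mul_ite, mul_one,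
    mul_zero]
  split_ifs with h
  · rw [Finset.sum_eq_single (⟨l, h⟩ : Fin i)]
    · simp
    · intro b _ hb
      rw [if_neg]
      rintro rfl
      exact hb rfl
    · simp
  · rw [Finset.sum_eq_zero, sub_zero]
    intro b _
    rw [if_neg]
    rintro rfl
    exact h b.2

lemma norm_deflated_sub_le (hM : M.PosSemidef) (hΛ : Antitone Λ)
    (hv : ∀ l, act M (v l) = Λ l • v l) (i : Fin p) (w : Vec p) :
    ‖deflated M Λ v i w - (Λ i * inner ℝ (v i) w) • v i‖
      ≤ eig Λ (i + 1) * ‖w - (inner ℝ (v i) w : ℝ) • v i‖ := by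
  have h0 := eigenvalue_nonneg hM hv
  have hnn := eig_nonneg h0 (i + 1)
  refine le_of_sq_le_sq ?_ (mul_nonneg hnn (norm_nonneg _))
  rw [mul_pow, norm_sq_eq_sum v, norm_sq_eq_sum v, Finset.mul_sum]
  refine Finset.sum_le_sum fun l _ => ?_
  rw [inner_sub_right, inner_sub_right, inner_basis_deflated hM hv, real_inner_smul_right,
    real_inner_smul_right, orthonormal_iff_ite.1 v.orthonormal]
  rcases lt_trichotomy l i with h | rfl | h
  · rw [if_pos h, if_neg h.ne]
    simp only [mul_zero, sub_zero, zero_pow two_ne_zero]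
    positivity
  · simp
  · rw [if_neg h.not_gt, if_neg h.ne']
    simp only [mul_zero, sub_zero]
    rw [mul_pow]
    have : Λ l ≤ eig Λ (i + 1) := by
      rw [← eig_coe Λ l]; exact eig_antitone h0 hΛ h
    exact mul_le_mul_of_nonneg_right (pow_le_pow_left₀ (h0 l) this 2) (sq_nonneg _)

/-- For accurate parents and a small finite-difference error, the gradient is within
`φ / 2` times the eigengap of its value for exact parents. -/
lemma norm_fdGrad_sub_deflated_le (hM : M.PosSemidef) (hΛ : Antitone Λ)
    (hv : ∀ l, act M (v l) = Λ l • v l) {c : ℕ → ℝ} {φ σ : ℝ} (i : Fin p) (hg : 0 < gap Λ i)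
    (hc0 : 0 ≤ c i) (hc : c i ≤ 1 / 16) (hcφ : 16 * c i ≤ φ) {u : ℕ → Vec p}
    (hu : AccurateParents Λ v c i u)
    (hE : ‖fdError M σ i u‖ < gap Λ i * φ / (2 * Real.pi)) {w : Vec p} (hw : ‖w‖ = 1) :
    ‖fdGrad M σ i u w - (2 : ℝ) • deflated M Λ v i w‖ ≤ 2 * (φ * gap Λ i / 4) := by
  have h0 := eigenvalue_nonneg hM hv
  have hφ : 0 ≤ φ := by linarith
  have hparent : ∀ j : Fin i, ‖(Λ (Fin.castLE i.2.le j) * inner ℝ (v (Fin.castLE i.2.le j)) w) •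
      v (Fin.castLE i.2.le j) - (inner ℝ (act M (u j)) w / form M (u j) (u j)) • act M (u j)‖
      ≤ 11 / 5 * (c i * gap Λ i / (i : ℕ)) := by
    intro j
    set l : Fin p := Fin.castLE i.2.le j
    have hi : (1 : ℝ) ≤ ((i : ℕ) : ℝ) := by
      exact_mod_cast (Nat.succ_le_of_lt ((Nat.zero_le _).trans_lt j.2))
    obtain ⟨hu1, hu2⟩ := hu l j.2
    have hΛ0 : 0 < eig Λ 0 := hg.trans_le (gap_le_eig_zero h0 hΛ i)
    have hgl : gap Λ i ≤ Λ l := by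
      rw [← eig_coe Λ l]
      exact (gap_le_eig h0 i).trans (eig_antitone h0 hΛ j.2.le)
    have hε : eig Λ 0 * parentTol Λ c i = c i * gap Λ i / (i : ℕ) := by
      rw [parentTol]; field_simp
    have hcg : c i * gap Λ i ≤ gap Λ i / 16 := by nlinarith
    have hcgi : c i * gap Λ i / (i : ℕ) ≤ c i * gap Λ i := div_le_self (by positivity) hi
    have hδ : parentTol Λ c i ≤ 1 / 16 := by
      have := gap_le_eig_zero h0 hΛ i
      refine le_of_mul_le_mul_left ?_ hΛ0
      linarith
    have := norm_deflation_term_sub_le hM hΛ hv hu1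
      ((norm_sub_le_angle hu1 (v.norm_eq_one l)).trans hu2) hδ (by linarith)
      (hg.trans_le hgl) w
    rw [norm_sub_rev]
    rwa [hw, mul_one, hε] at this
  have hsum : ‖∑ j : Fin i, ((Λ (Fin.castLE i.2.le j) *
      inner ℝ (v (Fin.castLE i.2.le j)) w) • v (Fin.castLE i.2.le j)
      - (inner ℝ (act M (u j)) w / form M (u j) (u j)) • act M (u j))‖
      ≤ 11 / 5 * (c i * gap Λ i) := by
    refine (norm_sum_le_of_le _ fun j _ => hparent j).trans ?_
    rw [Finset.sum_const, Finset.card_univ, Fintype.card_fin, nsmul_eq_mul]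
    have hcg : 0 ≤ c i * gap Λ i := by positivity
    have : ((i : ℕ) : ℝ) * (c i * gap Λ i / (i : ℕ)) ≤ c i * gap Λ i := by
      rw [mul_div_left_comm]
      exact mul_le_of_le_one_right hcg (div_self_le_one _)
    linarith
  have hdecomp : fdGrad M σ i u w - (2 : ℝ) • deflated M Λ v i w
      = (2 : ℝ) • ∑ j : Fin i, ((Λ (Fin.castLE i.2.le j) *
        inner ℝ (v (Fin.castLE i.2.le j)) w) • v (Fin.castLE i.2.le j)
        - (inner ℝ (act M (u j)) w / form M (u j) (u j)) • act M (u j)) + fdError M σ i u := by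
    rw [fdGrad, utilityGrad_eq, deflated, Finset.sum_range, Finset.sum_sub_distrib]
    module
  have hE' : ‖fdError M σ i u‖ ≤ φ * gap Λ i / 6 := by
    refine hE.le.trans ?_
    rw [mul_comm φ]
    exact div_le_div_of_nonneg_left (by positivity) (by norm_num)
      (by linarith [Real.pi_gt_three])
  have hcφg : 16 * c i * gap Λ i ≤ φ * gap Λ i := mul_le_mul_of_nonneg_right hcφ hg.le
  rw [hdecomp]
  refine (norm_add_le _ _).trans ?_
  rw [norm_smul, Real.norm_two]
  have : 0 ≤ φ * gap Λ i := by positivity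
  linarith

end Perturbation

/-! ### Cones around an eigenvector -/

section Cone

variable {E : Type*} [NormedAddCommGroup E] [InnerProductSpace ℝ E]

/-- The vectors whose angle with the unit vector `e` has a tangent of at most `τ`. -/
def InCone (e : E) (τ : ℝ) (w : E) : Prop :=
  0 < inner ℝ e w ∧ ‖w - (inner ℝ e w : ℝ) • e‖ ≤ τ * inner ℝ e w

lemma InCone.smul {e w : E} {τ r : ℝ} (h : InCone e τ w) (hr : 0 < r) : InCone e τ (r • w) := by
  obtain ⟨h1, h2⟩ := h
  refine ⟨by rw [real_inner_smul_right]; positivity, ?_⟩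
  rw [real_inner_smul_right, mul_smul, ← smul_sub, norm_smul, Real.norm_of_nonneg hr.le,
    mul_left_comm]
  exact mul_le_mul_of_nonneg_left h2 hr.le

lemma InCone.ne_zero {e w : E} {τ : ℝ} (h : InCone e τ w) : w ≠ 0 := by
  rintro rfl
  simpa using h.1

lemma inner_sub_inner_smul_eq_zero {e : E} (he : ‖e‖ = 1) (w : E) :
    inner ℝ e (w - (inner ℝ e w : ℝ) • e) = 0 := by
  rw [inner_sub_right, real_inner_smul_right, real_inner_self_eq_norm_sq, he]
  ring

lemma norm_sq_eq_inner_sq_add {e : E} (he : ‖e‖ = 1) (w : E) :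
    ‖w‖ ^ 2 = inner ℝ e w ^ 2 + ‖w - (inner ℝ e w : ℝ) • e‖ ^ 2 := by
  rw [norm_sub_sq_real, norm_smul, he, real_inner_smul_right, real_inner_comm, Real.norm_eq_abs,
    mul_one, sq_abs]
  ring

lemma InCone.angle_le {e w : E} {τ : ℝ} (he : ‖e‖ = 1) (h : InCone e τ w) : angle w e ≤ τ := by
  obtain ⟨h1, h2⟩ := h
  set x : ℝ := inner ℝ e w with hx
  set y := w - x • e with hy
  have hxe : x • e ≠ 0 := smul_ne_zero h1.ne' (by rw [← norm_ne_zero_iff, he]; exact one_ne_zero)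
  have hxy : inner ℝ (x • e) y = 0 := by
    rw [real_inner_smul_left, inner_sub_inner_smul_eq_zero he, mul_zero]
  have key := angle_add_eq_arctan_of_inner_eq_zero hxy hxe
  rw [show x • e + y = w by rw [hy]; abel, angle_smul_left_of_pos _ _ h1, norm_smul, he, mul_one,
    Real.norm_of_nonneg h1.le] at key
  rw [angle_comm, key]
  have h3 : ‖y‖ / x ≤ τ := (div_le_iff₀ h1).2 h2
  have h4 := Real.le_tan (Real.arctan_nonneg.2 (div_nonneg (norm_nonneg y) h1.le))
    (Real.arctan_lt_pi_div_two _)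
  rw [Real.tan_arctan] at h4
  exact h4.trans h3

lemma inCone_one_of_angle_le {e w : E} (he : ‖e‖ = 1) (hw : ‖w‖ = 1)
    (h : angle w e ≤ Real.pi / 4) : InCone e 1 w := by
  have hcos : inner ℝ e w = Real.cos (angle w e) := by
    rw [real_inner_comm, ← cos_angle_mul_norm_mul_norm, he, hw]; ring
  have h1 : √2 / 2 ≤ inner ℝ e w := by
    rw [hcos, ← Real.cos_pi_div_four]
    exact Real.cos_le_cos_of_nonneg_of_le_pi (angle_nonneg _ _)
      (by linarith [Real.pi_pos]) h
  have h2 : 0 < √2 / 2 := by positivity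
  refine ⟨h2.trans_le h1, ?_⟩
  rw [one_mul]
  refine le_of_sq_le_sq ?_ (h2.le.trans h1)
  have h3 := norm_sq_eq_inner_sq_add he w
  have h4 := pow_le_pow_left₀ h2.le h1 2
  rw [div_pow, Real.sq_sqrt zero_le_two] at h4
  rw [hw] at h3
  linarith

/-- One ascent step narrows the cone by the factor `1 - ρ` as long as the accuracy `φ` has not
been reached. Here `z` is half of the exact gradient, with growth rate `lam` along `e` and at
most `lam - g` across, and `G` is the gradient in use, with an error small against `φ g`. -/
lemma InCone.step {e w z G : E} {lam g φ τ α ρ : ℝ} (he : ‖e‖ = 1) (hw : ‖w‖ = 1)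
    (h : InCone e τ w) (hφτ : φ ≤ τ) (hτ0 : 0 ≤ τ) (hτ : τ ≤ 1) (hg : 0 ≤ g) (hα : 0 ≤ α)
    (hglam : g ≤ lam) (hρ1 : ρ < 1) (hρ : ρ * (1 + 2 * α * lam) ≤ α * g / 2) (hρ0 : 0 ≤ ρ)
    (hz : inner ℝ e z = lam * inner ℝ e w)
    (hz' : ‖z - (lam * inner ℝ e w) • e‖ ≤ (lam - g) * ‖w - (inner ℝ e w : ℝ) • e‖)
    (hG : ‖G - (2 : ℝ) • z‖ ≤ 2 * (φ * g / 4)) :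
    InCone e ((1 - ρ) * τ) (w + α • G) := by
  obtain ⟨hx, hy⟩ := h
  obtain ⟨d, rfl⟩ : ∃ d, G = (2 : ℝ) • z + d := ⟨G - (2 : ℝ) • z, by abel⟩
  rw [add_sub_cancel_left] at hG
  set x : ℝ := inner ℝ e w with hx_def
  set y := w - x • e
  have hη : ‖d‖ ≤ τ * g / 2 := by nlinarith
  -- the step is not homogeneous in `w`, so the unit length of `w` has to be paid for by `x`
  have hx1 : 1 ≤ 3 / 2 * x := by
    have h1 := norm_sq_eq_inner_sq_add he w
    rw [hw] at h1
    have h2 : ‖w - x • e‖ ^ 2 ≤ x ^ 2 := by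
      refine pow_le_pow_left₀ (norm_nonneg _) (hy.trans ?_) 2
      nlinarith
    nlinarith
  have hd : ‖d‖ ≤ 3 / 4 * τ * g * x := by
    have : 0 ≤ τ * g := mul_nonneg hτ0 hg
    nlinarith
  have hd_split := norm_sq_eq_inner_sq_add he d
  have hdx : |(inner ℝ e d : ℝ)| ≤ ‖d‖ := by
    simpa [he] using abs_real_inner_le_norm e d
  have hdy : ‖d - (inner ℝ e d : ℝ) • e‖ ≤ ‖d‖ :=
    le_of_sq_le_sq (by nlinarith) (norm_nonneg d)
  have hxnew : inner ℝ e (w + α • ((2 : ℝ) • z + d))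
      = (1 + 2 * α * lam) * x + α * inner ℝ e d := by
    rw [inner_add_right, real_inner_smul_right, inner_add_right, real_inner_smul_right, hz]
    ring
  have hxlow : ((1 + 2 * α * lam) - 3 / 4 * α * g) * x
      ≤ inner ℝ e (w + α • ((2 : ℝ) • z + d)) := by
    have h1 := mul_le_mul_of_nonneg_left ((neg_le_of_abs_le hdx)) hα
    have h2 := mul_le_mul_of_nonneg_left hd hα
    have h3 : α * g * x * τ ≤ α * g * x * 1 :=
      mul_le_mul_of_nonneg_left hτ (by positivity)
    rw [hxnew]
    linarith
  have hαg : 0 ≤ α * g := mul_nonneg hα hg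
  have hαl : α * g ≤ α * lam := mul_le_mul_of_nonneg_left hglam hα
  refine ⟨lt_of_lt_of_le (mul_pos (by linarith) hx) hxlow, ?_⟩
  have hynew : w + α • ((2 : ℝ) • z + d)
      - (inner ℝ e (w + α • ((2 : ℝ) • z + d)) : ℝ) • e
      = y + (2 * α) • (z - (lam * x) • e) + α • (d - (inner ℝ e d : ℝ) • e) := by
    rw [hxnew]
    module
  have hyle : ‖w + α • ((2 : ℝ) • z + d)
      - (inner ℝ e (w + α • ((2 : ℝ) • z + d)) : ℝ) • e‖
      ≤ (1 + 2 * α * (lam - g) + 3 / 4 * α * g) * (τ * x) := by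
    rw [hynew]
    refine (norm_add₃_le).trans ?_
    rw [norm_smul, norm_smul, Real.norm_of_nonneg hα, Real.norm_of_nonneg (by positivity)]
    have h1 : 2 * α * ‖z - (lam * x) • e‖ ≤ 2 * α * ((lam - g) * (τ * x)) :=
      mul_le_mul_of_nonneg_left
        (hz'.trans (mul_le_mul_of_nonneg_left hy (sub_nonneg.2 hglam))) (by positivity)
    have h2 := mul_le_mul_of_nonneg_left (hdy.trans hd) hα
    linarith
  refine hyle.trans ?_
  refine le_trans ?_ (mul_le_mul_of_nonneg_left hxlow (mul_nonneg (by linarith) hτ0))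
  have h1 : 1 + 2 * α * (lam - g) + 3 / 4 * α * g
      ≤ (1 - ρ) * ((1 + 2 * α * lam) - 3 / 4 * α * g) := by
    have : 0 ≤ ρ * (α * g) := mul_nonneg hρ0 hαg
    nlinarith
  have := mul_le_mul_of_nonneg_right h1 (mul_nonneg hτ0 hx.le)
  linarith

end Cone

/-! ### Convergence of a single player -/

section Player

variable {p : ℕ} {M : Matrix (Fin p) (Fin p) ℝ} {Λ : Fin p → ℝ}
  {v : OrthonormalBasis (Fin p) ℝ (Vec p)}

lemma play_succ (M : Matrix (Fin p) (Fin p) ℝ) (σ α : ℝ) (i : ℕ) (u : ℕ → Vec p) (w : Vec p)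
    (t : ℕ) : play M σ α i u w (t + 1) = fdStep M σ α i u (play M σ α i u w t) :=
  Function.iterate_succ_apply' _ _ _

/-- A crude count by Bernoulli's inequality. The logarithmic bound on `N` is not needed, since
the rate to be proved is quadratic in `1 / φ`. -/
lemma exists_pow_lt_and_mul_le_two {ρ φ : ℝ} (hρ : 0 < ρ) (hρ1 : ρ < 1) (hφ : 0 < φ)
    (hφ1 : φ ≤ 1) : ∃ N : ℕ, (1 - ρ) ^ N < φ ∧ (N : ℝ) * (ρ * φ) ≤ 2 := by
  have hρφ : 0 < ρ * φ := mul_pos hρ hφ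
  refine ⟨⌈1 / (ρ * φ)⌉₊, ?_, ?_⟩
  · set N := ⌈1 / (ρ * φ)⌉₊
    have hN : 1 ≤ N * (ρ * φ) := (div_le_iff₀ hρφ).1 (Nat.le_ceil _)
    have h1 : 1 + (N : ℝ) * ρ ≤ (1 + ρ) ^ N := one_add_mul_le_pow (by linarith) N
    have h2 : 0 < (1 - ρ) ^ N := pow_pos (by linarith) N
    have h3 : (1 - ρ) ^ N * (1 + ρ) ^ N ≤ 1 := by
      rw [← mul_pow]
      exact pow_le_one₀ (mul_nonneg (by linarith) (by linarith)) (by nlinarith)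
    have h4 := mul_le_mul_of_nonneg_left h1 h2.le
    by_contra! hcon
    have h5 := mul_le_mul_of_nonneg_right hcon (show 0 ≤ 1 + (N : ℝ) * ρ by positivity)
    linarith
  · have h1 := (Nat.ceil_lt_add_one (one_div_nonneg.2 hρφ.le)).le
    have h2 := mul_le_mul_of_nonneg_right h1 hρφ.le
    rw [add_mul, one_div_mul_cancel hρφ.ne'] at h2
    have : ρ * φ ≤ 1 * 1 := mul_le_mul hρ1.le hφ1 hφ.le zero_le_one
    linarith

/-- A player with accurate parents reaches the tolerance `φ ≤ 1` within `O(Λ₁₁ / (g_i φ))`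
iterations, and returns a unit vector. -/
theorem exists_play_angle_lt {a : ℝ} (ha : 0 < a) (hM : M.PosSemidef) (hΛ : Antitone Λ)
    (hv : ∀ l, act M (v l) = Λ l • v l) {c : ℕ → ℝ} {φ σ α : ℝ} (i : Fin p)
    (hg : 0 < gap Λ i) (hα : a ≤ α * eig Λ 0) (hφ : 0 < φ) (hφ1 : φ ≤ 1)
    (hc0 : 0 ≤ c i) (hcφ : 16 * c i ≤ φ) {u : ℕ → Vec p}
    (hu : AccurateParents Λ v c i u)
    (hE : ‖fdError M σ i u‖ < gap Λ i * φ / (2 * Real.pi)) {w : Vec p} (hw : ‖w‖ = 1)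
    (hwv : angle w (v i) ≤ Real.pi / 4) :
    ∃ t : ℕ, (t : ℝ) ≤ 4 * (1 + 2 * a) / a * (eig Λ 0 / (gap Λ i * φ)) ∧
      ‖play M σ α i u w t‖ = 1 ∧ angle (play M σ α i u w t) (v i) < φ := by
  have h0 := eigenvalue_nonneg hM hv
  have hgΛ0 := gap_le_eig_zero h0 hΛ i
  have hΛ0 : 0 < eig Λ 0 := hg.trans_le hgΛ0
  have hαpos : 0 < α := pos_of_mul_pos_left (ha.trans_le hα) hΛ0.le
  have he : ‖v i‖ = 1 := v.norm_eq_one i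
  -- the contraction factor `1 - ρ`; `s / (1 + 2 s)` is smallest at the left end `s = a`
  obtain ⟨ρ, hρ⟩ : ∃ ρ, ρ = gap Λ i / eig Λ 0 * (a / (2 * (1 + 2 * a))) := ⟨_, rfl⟩
  have hρ0 : 0 < ρ := by rw [hρ]; positivity
  have hρ1 : ρ < 1 := by
    have h1 : gap Λ i / eig Λ 0 ≤ 1 := (div_le_one hΛ0).2 hgΛ0
    have h2 : a / (2 * (1 + 2 * a)) < 1 := (div_lt_one (by positivity)).2 (by linarith)
    rw [hρ]
    exact mul_lt_one_of_nonneg_of_lt_one_right h1 (by positivity) h2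
  have hρα : ρ * (1 + 2 * α * Λ i) ≤ α * gap Λ i / 2 := by
    have h1 : ρ * (1 + 2 * α * Λ i) ≤ ρ * (1 + 2 * (α * eig Λ 0)) := by
      have := mul_le_mul_of_nonneg_left (eigenvalue_le_eig_zero h0 hΛ i) hαpos.le
      exact mul_le_mul_of_nonneg_left (by linarith) hρ0.le
    have h2 : a / (2 * (1 + 2 * a)) * (1 + 2 * (α * eig Λ 0)) ≤ α * eig Λ 0 / 2 := by
      rw [div_mul_eq_mul_div, div_le_div_iff₀ (by positivity) two_pos]
      linarith
    have h3 := mul_le_mul_of_nonneg_left h2 (show 0 ≤ gap Λ i / eig Λ 0 by positivity)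
    have h4 : gap Λ i / eig Λ 0 * (α * eig Λ 0 / 2) = α * gap Λ i / 2 := by field_simp
    rw [h4, ← mul_assoc, ← hρ] at h3
    exact h1.trans h3
  have hiter : ∀ N : ℕ,
      (∃ t ≤ N, ‖play M σ α i u w t‖ = 1 ∧ angle (play M σ α i u w t) (v i) < φ) ∨
      (‖play M σ α i u w N‖ = 1 ∧ InCone (v i) ((1 - ρ) ^ N) (play M σ α i u w N)) := by
    intro N
    induction N with
    | zero => exact Or.inr ⟨hw, by simpa [play] using inCone_one_of_angle_le he hw hwv⟩
    | succ N ih =>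
      rcases ih with ⟨t, ht, h⟩ | ⟨h1, h2⟩
      · exact Or.inl ⟨t, ht.trans N.le_succ, h⟩
      rcases lt_or_ge ((1 - ρ) ^ N) φ with h3 | h3
      · exact Or.inl ⟨N, N.le_succ, h1, (h2.angle_le he).trans_lt h3⟩
      right
      rw [play_succ]
      set w' := play M σ α i u w N
      have hdefl := norm_deflated_sub_le hM hΛ hv i w'
      rw [show eig Λ (i + 1) = Λ i - gap Λ i by rw [gap, eig_coe]; ring] at hdefl
      have hcone := h2.step (G := fdGrad M σ i u w') (z := deflated M Λ v i w') he h1 h3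
        (pow_nonneg (by linarith) N) (pow_le_one₀ (by linarith) (by linarith)) hg.le hαpos.le
        ((gap_le_eig h0 i).trans_eq (eig_coe Λ i)) hρ1 hρα hρ0.le
        (by rw [inner_basis_deflated hM hv, if_neg (lt_irrefl i)])
        hdefl (norm_fdGrad_sub_deflated_le hM hΛ hv i hg hc0 (by linarith) hcφ hu hE h1)
      have hne := norm_pos_iff.2 hcone.ne_zero
      rw [← pow_succ'] at hcone
      refine ⟨?_, hcone.smul (inv_pos.2 hne)⟩
      rw [fdStep, norm_smul, norm_inv, norm_norm, inv_mul_cancel₀ hne.ne']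
  obtain ⟨N, hN, hNle⟩ := exists_pow_lt_and_mul_le_two hρ0 hρ1 hφ hφ1
  have hbound : ∀ t ≤ N, (t : ℝ) ≤ 4 * (1 + 2 * a) / a * (eig Λ 0 / (gap Λ i * φ)) := by
    intro t ht
    have h1 : (t : ℝ) ≤ N := by exact_mod_cast ht
    refine h1.trans (((le_div_iff₀ (mul_pos hρ0 hφ)).2 hNle).trans_eq ?_)
    rw [hρ]
    field_simp
    ring
  rcases hiter N with ⟨t, ht, h⟩ | ⟨h1, h2⟩
  · exact ⟨t, hbound t ht, h⟩
  · exact ⟨N, hbound N le_rfl, h1, (h2.angle_le he).trans_lt hN⟩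

end Player

/-! ### The accuracy constants -/

section Constants

variable {p : ℕ} {Λ : Fin p → ℝ} {k : ℕ} {φ : ℝ}

lemma seqConst_pos (hΛ0 : 0 < eig Λ 0) (hgap : ∀ i < k, 0 < gap Λ i) (hφ : 0 < φ) (i : ℕ) :
    0 < seqConst Λ k φ i := by
  have : 0 < ∏ j ∈ Finset.Ico (i + 1) k, gap Λ j :=
    Finset.prod_pos fun j hj => hgap j (Finset.mem_Ico.1 hj).2
  unfold seqConst
  positivity

lemma parentTol_seqConst_succ (hΛ0 : 0 < eig Λ 0) {i : ℕ} (hi : i + 1 < k) :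
    parentTol Λ (seqConst Λ k φ) (i + 1) = 16 * seqConst Λ k φ i := by
  have hk : k - 1 - i = k - 1 - (i + 1) + 1 := by omega
  rw [parentTol, seqConst, seqConst, Finset.prod_eq_prod_Ico_succ_bot hi, hk, pow_succ,
    Nat.factorial_succ]
  push_cast
  field_simp

lemma sixteen_mul_seqConst_le_succ (h0 : ∀ l, 0 ≤ Λ l) (hΛ : Antitone Λ) (hΛ0 : 0 < eig Λ 0)
    (hgap : ∀ i < k, 0 < gap Λ i) (hφ : 0 < φ) {i : ℕ} (hi : i + 1 < k) :
    16 * seqConst Λ k φ i ≤ seqConst Λ k φ (i + 1) := by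
  have hc := (seqConst_pos hΛ0 hgap hφ (i + 1)).le
  rw [← parentTol_seqConst_succ hΛ0 hi, parentTol]
  refine div_le_of_le_mul₀ (by positivity) hc (mul_le_mul_of_nonneg_left ?_ hc)
  refine (gap_le_eig_zero h0 hΛ _).trans (le_mul_of_one_le_left hΛ0.le ?_)
  exact_mod_cast Nat.succ_le_succ (Nat.zero_le i)

lemma seqConst_mono (h0 : ∀ l, 0 ≤ Λ l) (hΛ : Antitone Λ) (hΛ0 : 0 < eig Λ 0)
    (hgap : ∀ i < k, 0 < gap Λ i) (hφ : 0 < φ) {i j : ℕ} (hij : i ≤ j) (hj : j < k) :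
    seqConst Λ k φ i ≤ seqConst Λ k φ j := by
  induction j, hij using Nat.le_induction with
  | base => rfl
  | succ j hij ih =>
    have h1 := sixteen_mul_seqConst_le_succ h0 hΛ hΛ0 hgap hφ hj
    have h2 := seqConst_pos hΛ0 hgap hφ j
    linarith [ih (by omega)]

lemma sixteen_mul_seqConst_le (h0 : ∀ l, 0 ≤ Λ l) (hΛ : Antitone Λ) (hΛ0 : 0 < eig Λ 0)
    (hgap : ∀ i < k, 0 < gap Λ i) (hφ : 0 < φ) {i : ℕ} (hi : i < k) :
    16 * seqConst Λ k φ i ≤ φ := by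
  have h1 := seqConst_mono h0 hΛ hΛ0 hgap hφ (Nat.le_sub_one_of_lt hi) (by omega)
  have h2 : seqConst Λ k φ (k - 1) = φ / 16 := by
    have h3 : ((k - 1).factorial : ℝ) ≠ 0 := by positivity
    rw [seqConst, Finset.Ico_eq_empty (by omega), Nat.sub_self]
    simp [h3]
  linarith

/-- A vector as accurate as player `j` has to be is accurate enough for every later player. -/
lemma sixteen_mul_seqConst_le_parentTol (h0 : ∀ l, 0 ≤ Λ l) (hΛ : Antitone Λ)
    (hΛ0 : 0 < eig Λ 0) (hgap : ∀ i < k, 0 < gap Λ i) (hφ : 0 < φ) {i j : ℕ} (hji : j < i)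
    (hi : i < k) : 16 * seqConst Λ k φ j ≤ parentTol Λ (seqConst Λ k φ) i := by
  obtain ⟨i, rfl⟩ : ∃ n, i = n + 1 := ⟨i - 1, by omega⟩
  rw [parentTol_seqConst_succ hΛ0 hi]
  linarith [seqConst_mono h0 hΛ hΛ0 hgap hφ (Nat.le_of_lt_succ hji) (by omega)]

end Constants

/-! ### Counting iterations -/

section Rate

variable {p : ℕ} {M : Matrix (Fin p) (Fin p) ℝ} {Λ : Fin p → ℝ} {k : ℕ} {φ : ℝ}

/-- The quantity `(k-1)!/φ * ∏_j (16 Λ₁₁ / g_j)` whose square governs the iteration count. -/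
noncomputable def difficulty (Λ : Fin p → ℝ) (k : ℕ) (φ : ℝ) : ℝ :=
  (Nat.factorial (k - 1) : ℝ) / φ * ∏ j ∈ Finset.range k, (16 * eig Λ 0 / gap Λ j)

lemma pow_le_prod_ratio (h0 : ∀ l, 0 ≤ Λ l) (hΛ : Antitone Λ)
    (hgap : ∀ i < k, 0 < gap Λ i) {i : ℕ} (hi : i ≤ k) :
    (16 : ℝ) ^ i ≤ ∏ j ∈ Finset.range i, (16 * eig Λ 0 / gap Λ j) := by
  have h : ∏ _j ∈ Finset.range i, (16 : ℝ) = 16 ^ i := by simp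
  rw [← h]
  refine Finset.prod_le_prod (fun _ _ => by norm_num) fun j hj => ?_
  rw [le_div_iff₀ (hgap j ((Finset.mem_range.1 hj).trans_le hi))]
  linarith [gap_le_eig_zero h0 hΛ j]

lemma one_le_difficulty (h0 : ∀ l, 0 ≤ Λ l) (hΛ : Antitone Λ)
    (hgap : ∀ i < k, 0 < gap Λ i) (hφ : 0 < φ) (hφ1 : φ ≤ 1) : 1 ≤ difficulty Λ k φ := by
  refine one_le_mul_of_one_le_of_one_le ?_
    ((one_le_pow₀ (by norm_num)).trans (pow_le_prod_ratio h0 hΛ hgap le_rfl))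
  rw [one_le_div hφ]
  exact hφ1.trans (by exact_mod_cast Nat.factorial_pos _)

lemma ratio_div_seqConst_mul_eq_difficulty (hΛ0 : 0 < eig Λ 0) (hgap : ∀ i < k, 0 < gap Λ i)
    (hφ : 0 < φ) {i : ℕ} (hi : i < k) :
    16 * eig Λ 0 / (gap Λ i * (16 * seqConst Λ k φ i)) *
      ((Nat.factorial i : ℝ) * ∏ j ∈ Finset.range i, (16 * eig Λ 0 / gap Λ j))
      = difficulty Λ k φ := by
  have hG : 0 < ∏ j ∈ Finset.Ico (i + 1) k, gap Λ j :=
    Finset.prod_pos fun j hj => hgap j (Finset.mem_Ico.1 hj).2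
  have hgi := hgap i hi
  rw [difficulty, ← Finset.prod_range_mul_prod_Ico _ hi.le,
    Finset.prod_eq_prod_Ico_succ_bot hi, Finset.prod_div_distrib (s := Finset.Ico (i + 1) k),
    Finset.prod_const, Nat.card_Ico, seqConst, show k - (i + 1) = k - 1 - i by omega]
  generalize ∏ j ∈ Finset.range i, (16 * eig Λ 0 / gap Λ j) = P
  field_simp

/-- The iteration counts are bounded by a geometric series in `i`, since `difficulty` contains
the factors of the players before `i` as well, each of them at least `16`. -/
lemma ratio_div_le (h0 : ∀ l, 0 ≤ Λ l) (hΛ : Antitone Λ) (hΛ0 : 0 < eig Λ 0)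
    (hgap : ∀ i < k, 0 < gap Λ i) (hφ : 0 < φ) {i : ℕ} (hi : i < k) {ψ : ℝ}
    (hψ : 16 * seqConst Λ k φ i ≤ ψ) :
    eig Λ 0 / (gap Λ i * ψ) ≤ difficulty Λ k φ / 16 * (1 / 2) ^ i := by
  have hgi := hgap i hi
  have hc := seqConst_pos hΛ0 hgap hφ i
  have h1 : eig Λ 0 / (gap Λ i * ψ) ≤ eig Λ 0 / (gap Λ i * (16 * seqConst Λ k φ i)) :=
    div_le_div_of_nonneg_left hΛ0.le (by positivity) (mul_le_mul_of_nonneg_left hψ hgi.le)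
  have h2 : (2 : ℝ) ^ i ≤ (Nat.factorial i : ℝ) *
      ∏ j ∈ Finset.range i, (16 * eig Λ 0 / gap Λ j) := by
    have h3 : (1 : ℝ) ≤ Nat.factorial i := by exact_mod_cast Nat.factorial_pos i
    have h4 : (2 : ℝ) ^ i ≤ 16 ^ i := pow_le_pow_left₀ (by norm_num) (by norm_num) i
    have h5 := h4.trans (pow_le_prod_ratio h0 hΛ hgap hi.le)
    exact h5.trans (le_mul_of_one_le_left ((by positivity : (0 : ℝ) ≤ 2 ^ i).trans h5) h3)
  have h6 := mul_le_mul_of_nonneg_left h2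
    (show 0 ≤ 16 * eig Λ 0 / (gap Λ i * (16 * seqConst Λ k φ i)) by positivity)
  rw [ratio_div_seqConst_mul_eq_difficulty hΛ0 hgap hφ hi] at h6
  refine h1.trans ?_
  rw [one_div, inv_pow, ← div_eq_mul_inv, le_div_iff₀ (by positivity),
    le_div_iff₀ (by norm_num)]
  calc _ = 16 * eig Λ 0 / (gap Λ i * (16 * seqConst Λ k φ i)) * 2 ^ i := by ring
    _ ≤ _ := h6

lemma lipBound_nonneg (h0 : ∀ l, 0 ≤ Λ l) {c : ℕ → ℝ} {i : ℕ} (hc : 0 ≤ c i)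
    (hg : 0 ≤ gap Λ i) (σ : ℝ) : 0 ≤ lipBound M Λ c i σ := by
  have h1 := eig_nonneg h0
  have h2 : 0 ≤ kappa Λ (i - 1) := div_nonneg (h1 _) (h1 _)
  have h3 := h1 0
  unfold lipBound
  split_ifs <;> positivity

/-- The first player alone accounts for this part of the rate: its finite-difference error
`σ diag M` involves no parents, so its ratio `L₁(0) / L₁(σ)` is bounded below. -/
lemma difficulty_sq_le_iterRate (h0 : ∀ l, 0 ≤ Λ l) (hk : 0 < k) (hΛ0 : 0 < eig Λ 0)
    (hgap : ∀ i < k, 0 < gap Λ i) {c : ℕ → ℝ} (hc : ∀ i < k, 0 ≤ c i) {σ : ℝ} {u : ℕ → Vec p}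
    (hE : ‖fdError M σ 0 u‖ ≤ eig Λ 0) :
    4 / 5 * difficulty Λ k φ ^ 2 ≤ iterRate M Λ c k σ φ := by
  have hE' : |σ| * ‖diagVec M‖ ≤ eig Λ 0 := by
    simpa [fdError, norm_smul] using hE
  have h1 : 4 / 5 ≤ lipBound M Λ c 0 0 / lipBound M Λ c 0 σ := by
    simp only [lipBound, if_true, abs_zero, zero_mul, add_zero]
    rw [div_le_div_iff₀ (by norm_num) (by positivity)]
    linarith
  refine (mul_le_mul_of_nonneg_right h1 (sq_nonneg _)).trans ?_
  exact Finset.single_le_sum (f := fun i => lipBound M Λ c i 0 / lipBound M Λ c i σ *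
    difficulty Λ k φ ^ 2) (fun i hi => by
      have hi := Finset.mem_range.1 hi
      exact mul_nonneg (div_nonneg (lipBound_nonneg h0 (hc i hi) (hgap i hi).le 0)
        (lipBound_nonneg h0 (hc i hi) (hgap i hi).le σ)) (sq_nonneg _)) (Finset.mem_range.2 hk)

lemma sum_iterations_le_ceil (h0 : ∀ l, 0 ≤ Λ l) (hΛ : Antitone Λ) (hk : 0 < k)
    (hΛ0 : 0 < eig Λ 0) (hgap : ∀ i < k, 0 < gap Λ i) (hφ : 0 < φ) (hφ1 : φ ≤ 1) {c : ℕ → ℝ}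
    (hc : ∀ i < k, 0 ≤ c i) {σ : ℝ} {u : ℕ → Vec p} (hE : ‖fdError M σ 0 u‖ ≤ eig Λ 0) {C : ℝ}
    (hC : 0 ≤ C) {ψ : ℕ → ℝ} (hψ : ∀ i < k, 16 * seqConst Λ k φ i ≤ ψ i) {t : ℕ → ℕ}
    (ht : ∀ i < k, (t i : ℝ) ≤ C * (eig Λ 0 / (gap Λ i * ψ i))) :
    ∑ i ∈ Finset.range k, t i ≤ ⌈C * iterRate M Λ c k σ φ⌉₊ := by
  have hX := one_le_difficulty h0 hΛ hgap hφ hφ1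
  have hrate := difficulty_sq_le_iterRate (φ := φ) h0 hk hΛ0 hgap hc hE
  have hsum : (∑ i ∈ Finset.range k, (t i : ℝ)) ≤ C * (difficulty Λ k φ / 16) * 2 := by
    calc (∑ i ∈ Finset.range k, (t i : ℝ))
        ≤ ∑ i ∈ Finset.range k, C * (difficulty Λ k φ / 16) * (1 / 2) ^ i := by
          refine Finset.sum_le_sum fun i hi => ?_
          have hi := Finset.mem_range.1 hi
          rw [mul_assoc]
          exact (ht i hi).trans (mul_le_mul_of_nonneg_left
            (ratio_div_le h0 hΛ hΛ0 hgap hφ hi (hψ i hi)) hC)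
      _ ≤ C * (difficulty Λ k φ / 16) * 2 := by
          rw [← Finset.mul_sum]
          exact mul_le_mul_of_nonneg_left (sum_geometric_two_le k) (by positivity)
  have hle : C * (difficulty Λ k φ / 16) * 2 ≤ C * iterRate M Λ c k σ φ := by
    rw [mul_assoc]
    refine mul_le_mul_of_nonneg_left ?_ hC
    nlinarith
  exact_mod_cast (by push_cast; exact (hsum.trans hle).trans (Nat.le_ceil _) :
    ((∑ i ∈ Finset.range k, t i : ℕ) : ℝ) ≤ (⌈C * iterRate M Λ c k σ φ⌉₊ : ℕ))

end Rate

/-! ### The players in sequence -/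

section Sequence

variable {p : ℕ} {M : Matrix (Fin p) (Fin p) ℝ} {Λ : Fin p → ℝ}
  {v : OrthonormalBasis (Fin p) ℝ (Vec p)}

lemma eigenGame_congr (M : Matrix (Fin p) (Fin p) ℝ) (σ α : ℝ) (init : ℕ → Vec p)
    {t t' : ℕ → ℕ} (i : ℕ) (h : ∀ j ≤ i, t j = t' j) :
    eigenGame M σ α init t i = eigenGame M σ α init t' i := by
  induction i using Nat.strong_induction_on with
  | _ i ih =>
    rw [eigenGame, eigenGame.eq_def M σ α init t', h i le_rfl]
    congr 1
    funext j
    split_ifs with hj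
    · exact ih j hj fun l hl => h l (hl.trans hj.le)
    · rfl

/-- If every player can be run accurately on accurate parents, then the whole game can: the
iteration counts are chosen player by player. -/
lemma exists_iterations_of_forall_player {k : ℕ} {σ α : ℝ} {init : ℕ → Vec p}
    {Q : ℕ → ℕ → Prop} {R : ℕ → Vec p → Prop}
    (h : ∀ i < k, ∀ u : ℕ → Vec p, (∀ j < i, R j (u j)) →
      ∃ t, Q i t ∧ R i (play M σ α i u (init i) t)) :
    ∃ t : ℕ → ℕ, ∀ i < k, Q i (t i) ∧ R i (eigenGame M σ α init t i) := by
  induction k with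
  | zero => exact ⟨fun _ => 0, fun i hi => absurd hi (Nat.not_lt_zero i)⟩
  | succ n ih =>
    obtain ⟨t, ht⟩ := ih fun i hi => h i (hi.trans n.lt_succ_self)
    obtain ⟨s, hs1, hs2⟩ := h n n.lt_succ_self
      (fun j => if _h : j < n then eigenGame M σ α init t j else 0)
      (fun j hj => by rw [dif_pos hj]; exact (ht j hj).2)
    have hcongr : ∀ i < n, eigenGame M σ α init (Function.update t n s) i
        = eigenGame M σ α init t i := fun i hi =>
      eigenGame_congr M σ α init i fun j hj =>
        Function.update_of_ne (hj.trans_lt hi).ne s t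
    refine ⟨Function.update t n s, fun i hi => ?_⟩
    rcases (Nat.lt_succ_iff_lt_or_eq.1 hi) with hi | rfl
    · rw [hcongr i hi, Function.update_of_ne hi.ne]
      exact ht i hi
    · rw [Function.update_self, eigenGame, Function.update_self]
      refine ⟨hs1, ?_⟩
      convert hs2 using 2
      funext j
      split_ifs with hj
      · exact hcongr j hj
      · rfl

end Sequence

end ZerothEigenGame

open ZerothEigenGame InnerProductGeometry in
theorem mainTheorem1 :
    -- the constant of the rate depends only on a lower bound `a` of the step size times `Λ₁₁`
    ∀ a : ℝ, 0 < a → ∃ C : ℝ, 0 < C ∧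
    ∀ (p k : ℕ) (_hk : 0 < k) (hkp : k ≤ p)
      (M : Matrix (Fin p) (Fin p) ℝ) (_hM : M.PosSemidef)
      (Λ : Fin p → ℝ) (_hΛ : Antitone Λ)
      (v : OrthonormalBasis (Fin p) ℝ (Vec p)) (_hv : ∀ l, act M (v l) = Λ l • v l)
      (_hgap : ∀ i < k, 0 < gap Λ i)
      (σ α φ : ℝ) (_hα : a ≤ α * eig Λ 0) (_hφ : 0 < φ)
      (init : ℕ → Vec p)
      (_hinit : ∀ i : Fin k, ‖init i‖ = 1 ∧ angle (init i) (v (Fin.castLE hkp i)) ≤ Real.pi / 4),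
      -- every player, run with parents that are accurate enough
      (∀ (c : ℕ → ℝ) (u : ℕ → ℕ → Vec p),
        (∀ i < k, 0 ≤ c i ∧ c i ≤ 1 / 16 ∧ 16 * c i ≤ φ) →
        (∀ i < k, AccurateParents Λ v c i (u i)) →
        (∀ i < k, ‖fdError M σ i (u i)‖ < gap Λ i * φ / (2 * Real.pi)) →
        (∀ i < k, ∀ w : Vec p, ‖w‖ = 1 → ‖fdGrad M σ i (u i) w‖ ≤ lipBound M Λ c i σ) ∧
        ∃ t : ℕ → ℕ,
          ∑ i ∈ Finset.range k, t i ≤ ⌈C * iterRate M Λ c k σ φ⌉₊ ∧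
          ∀ i : Fin k, angle (play M σ α i (u i) (init i) (t i)) (v (Fin.castLE hkp i)) < φ) ∧
      -- all players in sequence, each one using the outputs of its predecessors as parents
      ((∀ i < k, ∀ u : ℕ → Vec p, AccurateParents Λ v (seqConst Λ k φ) i u →
          ‖fdError M σ i u‖ < 8 * seqConst Λ k φ i * gap Λ i / Real.pi) →
        ∃ t : ℕ → ℕ,
          ∑ i ∈ Finset.range k, t i ≤ ⌈C * iterRate M Λ (seqConst Λ k φ) k σ φ⌉₊ ∧
          (∀ i : Fin k,
            angle (eigenGame M σ α init t i) (v (Fin.castLE hkp i)) < φ) ∧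
          (φ ≤ 1 → ∀ i < k,
            AccurateParents Λ v (seqConst Λ k φ) i (eigenGame M σ α init t))) := by
  intro a ha
  refine ⟨4 * (1 + 2 * a) / a, by positivity, ?_⟩
  intro p k hk hkp M hM Λ hΛ v hv hgap σ α φ hα hφ init hinit
  have h0 := eigenvalue_nonneg hM hv
  have hΛ0 : 0 < eig Λ 0 := (hgap 0 hk).trans_le (gap_le_eig_zero h0 hΛ 0)
  have hC : 0 ≤ 4 * (1 + 2 * a) / a := by positivity
  -- beyond tolerance `1 > π / 4` the initial vectors are good enough
  have hinit_lt : 1 < φ → ∀ i : Fin k, angle (init i) (v (Fin.castLE hkp i)) < φ := fun h i =>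
    (hinit i).2.trans_lt (by linarith [Real.pi_lt_four])
  refine ⟨fun c u hc hu hE => ⟨fun i hi w hw => ?_, ?_⟩, fun hE => ?_⟩
  · exact norm_fdGrad_le_lipBound hM hΛ hv (hc i hi).1 (hgap i hi).le
      (hgap (i - 1) (by omega)) σ (u i) w hw
  · rcases lt_or_ge 1 φ with hφ1 | hφ1
    · exact ⟨fun _ => 0, by simp, hinit_lt hφ1⟩
    have hplay : ∀ i : Fin k, ∃ t : ℕ,
        (t : ℝ) ≤ 4 * (1 + 2 * a) / a * (eig Λ 0 / (gap Λ i * φ)) ∧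
        ‖play M σ α i (u i) (init i) t‖ = 1 ∧
        angle (play M σ α i (u i) (init i) t) (v (Fin.castLE hkp i)) < φ := fun i =>
      exists_play_angle_lt ha hM hΛ hv (Fin.castLE hkp i) (hgap i i.2) hα hφ hφ1
        (hc i i.2).1 (hc i i.2).2.2 (hu i i.2) (hE i i.2) (hinit i).1 (hinit i).2
    choose t ht using hplay
    refine ⟨fun i => if h : i < k then t ⟨i, h⟩ else 0, ?_, fun i => ?_⟩
    · have hE0 : ‖fdError M σ 0 (u 0)‖ ≤ eig Λ 0 := by
        refine (hE 0 hk).le.trans (div_le_of_le_mul₀ (by positivity) hΛ0.le ?_)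
        have := gap_le_eig_zero h0 hΛ 0
        exact mul_le_mul this (by linarith [Real.pi_gt_three]) hφ.le hΛ0.le
      refine sum_iterations_le_ceil h0 hΛ hk hΛ0 hgap hφ hφ1 (fun i hi => (hc i hi).1) hE0 hC
        (ψ := fun _ => φ) (fun i hi => sixteen_mul_seqConst_le h0 hΛ hΛ0 hgap hφ hi) ?_
      intro i hi
      simp only [hi, dif_pos]
      exact (ht ⟨i, hi⟩).1
    · simp only [i.2, dif_pos]
      exact (ht i).2.2
  · rcases lt_or_ge 1 φ with hφ1 | hφ1
    · refine ⟨fun _ => 0, by simp, fun i => ?_, fun h => absurd h hφ1.not_ge⟩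
      rw [eigenGame]
      exact hinit_lt hφ1 i
    have hc := fun i (_ : i < k) => (seqConst_pos hΛ0 hgap hφ i).le
    have h16 := fun i (hi : i < k) => sixteen_mul_seqConst_le h0 hΛ hΛ0 hgap hφ hi
    have haccurate : ∀ i < k, ∀ u : ℕ → Vec p,
        (∀ j < i, ∀ hj : j < p, ‖u j‖ = 1 ∧
          angle (u j) (v ⟨j, hj⟩) < 16 * seqConst Λ k φ j) →
        AccurateParents Λ v (seqConst Λ k φ) i u := fun i hi u hu j hj =>
      ⟨(hu j hj j.2).1, (hu j hj j.2).2.le.trans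
        (sixteen_mul_seqConst_le_parentTol h0 hΛ hΛ0 hgap hφ hj hi)⟩
    obtain ⟨t, ht⟩ := exists_iterations_of_forall_player (k := k) (M := M) (σ := σ) (α := α)
      (init := init)
      (Q := fun i t => (t : ℝ) ≤ 4 * (1 + 2 * a) / a *
        (eig Λ 0 / (gap Λ i * (16 * seqConst Λ k φ i))))
      (R := fun i w => ∀ hi : i < p, ‖w‖ = 1 ∧ angle w (v ⟨i, hi⟩) < 16 * seqConst Λ k φ i)
      (fun i hi u hu => by
        have hacc := haccurate i hi u hu
        have hc_pos := seqConst_pos hΛ0 hgap hφ i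
        have hEi : ‖fdError M σ i u‖
            < gap Λ i * (16 * seqConst Λ k φ i) / (2 * Real.pi) :=
          (hE i hi u hacc).trans_eq (by field_simp; ring)
        obtain ⟨t, ht1, ht2⟩ := exists_play_angle_lt ha hM hΛ hv ⟨i, hi.trans_le hkp⟩
          (hgap i hi) hα (φ := 16 * seqConst Λ k φ i) (by positivity) ((h16 i hi).trans hφ1)
          (hc i hi) le_rfl hacc hEi (hinit ⟨i, hi⟩).1 (hinit ⟨i, hi⟩).2
        exact ⟨t, ht1, fun _ => ht2⟩)
    refine ⟨t, ?_, fun i => ?_, fun _ i hi => ?_⟩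
    · have hE0 : ‖fdError M σ 0 (fun _ => (0 : Vec p))‖ ≤ eig Λ 0 := by
        refine (hE 0 hk _ fun j hj => absurd hj (Nat.not_lt_zero _)).le.trans
          (div_le_of_le_mul₀ Real.pi_pos.le hΛ0.le ?_)
        rw [mul_comm]
        have := h16 0 hk
        exact mul_le_mul (gap_le_eig_zero h0 hΛ 0) (by linarith [Real.pi_gt_three])
          (by linarith [hc 0 hk]) hΛ0.le
      exact sum_iterations_le_ceil h0 hΛ hk hΛ0 hgap hφ hφ1 hc hE0 hC
        (ψ := fun i => 16 * seqConst Λ k φ i) (fun _ _ => le_rfl) fun i hi => (ht i hi).1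
    · exact ((ht i i.2).2 (i.2.trans_le hkp)).2.trans_le (h16 i i.2)
    · exact haccurate i hi _ fun j hj => (ht j (hj.trans hi)).2
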